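/- Terminology. A \emph{cpo with bottom} is a partially ordered set with a least element $\bot$ in which every $\omega$-chain has a join. A category $\mathbf{C}$ is \emph{$\mathbf{Cppo}$-enriched} if each hom-set $\mathbf{C}(X,Y)$ carries the structure of a cpo with bottom $\bot_{X,Y}$ and composition preserves joins of $\omega$-chains in each of its two arguments; its composition is \emph{left strict} if $\bot_{Y,Z}\circ f=\bot_{X,Z}$ for all $f\colon X\to Y$ and all $Z$. An endofunctor $F$ of such a category is \emph{locally continuous} if each map $\mathbf{C}(X,Y)\to\mathbf{C}(FX,FY)$, $f\mapsto Ff$, preserves joins of $\omega$-chains. An endofunctor is \emph{accessible} if it preserves $\lambda$-filtered colimits for some (regular) cardinal $\lambda$. For a monad $M$ on $\mathbf{Sets}$, let $\mathcal{K}\ell(M)$ be its Kleisli category and $\mathcal{J}\colon\mathbf{Sets}\to\mathcal{K}\ell(M)$ the canonical functor, which is the identity on objects; a \emph{lifting} of $H\colon\mathbf{Sets}\to\mathbf{Sets}$ is an endofunctor $\overline{H}$ of $\mathcal{K}\ell(M)$ with $\mathcal{J}\circ H=\overline{H}\circ\mathcal{J}$. If an endofunctor $F$ of a category has a free $F$-algebra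 $F^*Y$ on every object $Y$, then $F^*$ denotes the \emph{free monad} on $F$: its unit is given by the universal morphisms $\eta_Y\colon Y\to F^*Y$, and its multiplication at $Y$ is the unique $F$-algebra homomorphism $\mu_Y\colon F^*F^*Y\to F^*Y$ with $\mu_Y\circ\eta_{F^*Y}=\mathrm{id}$. In a category with coproducts, an object $E$ yields the \emph{exception monad} $E+\mathrm{Id}$. Theorem. Let $M$ be a monad on $\mathbf{Sets}$ such that $\mathcal{K}\ell(M)$ is $\mathbf{Cppo}$-enriched with left strict composition. Let $H\colon\mathbf{Sets}\to\mathbf{Sets}$ be an accessible functor with a locally continuous lifting $\overline{H}\colon\mathcal{K}\ell(M)\to\mathcal{K}\ell(M)$, and let $X$ be a set. Then: \begin{enumerate} \item $\mathcal{K}\ell(M)$ is a $\mathbf{Cppo}$-enriched category with (small) coproducts and left strict composition, and $\overline{H}$ is a locally continuous endofunctor of it; \item there is a free $\overline{H}$-algebra on every object of $\mathcal{K}\ell(M)$, so that the free monad $\overline{H}^{*}$ exists; \item for every object $Y$ of $\mathcal{K}\ell(M)$, the endofunctor $\overline{H}^{*}(\mathrm{Id}+Y)$ of $\mathcal{K}\ell(M)$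 has an initial algebra; \item for every object $Y$ of $\mathcal{K}\ell(M)$, the endofunctor $\overline{H}\mathcal{J}X+(\mathrm{Id}+Y)$ of $\mathcal{K}\ell(M)$, obtained by composing the exception monad $\overline{H}\mathcal{J}X+\mathrm{Id}$ with $\mathrm{Id}+Y$, has an initial algebra. \end{enumerate} -/

import Mathlib

open CategoryTheory CategoryTheory.Limits OmegaCompletePartialOrder

universe v u

namespace InternalSystems

section CppoEnrichment

/-- A `Cppo`-enrichment of a category: every hom-set is a partial order in which all
`ω`-chains have a join and which has a least element, and composition is continuous
(preserves joins of `ω`-chains) in each of its two arguments. -/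
class CppoEnriched (C : Type u) [Category.{v} C] where
  homCpo (X Y : C) : OmegaCompletePartialOrder (X ⟶ Y)
  homBot (X Y : C) : OrderBot (X ⟶ Y)
  continuous_postcomp {X Y Z : C} (g : Y ⟶ Z) :
    ωScottContinuous (fun f : X ⟶ Y => f ≫ g)
  continuous_precomp {X Y Z : C} (f : X ⟶ Y) :
    ωScottContinuous (fun g : Y ⟶ Z => f ≫ g)

instance {C : Type u} [Category.{v} C] [CppoEnriched C] (X Y : C) :
    OmegaCompletePartialOrder (X ⟶ Y) := CppoEnriched.homCpo X Y

instance {C : Type u} [Category.{v} C] [CppoEnriched C] (X Y : C) :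
    OrderBot (X ⟶ Y) := CppoEnriched.homBot X Y

/-- Composition is left strict: `⊥ ∘ f = ⊥` for every morphism `f`. -/
def LeftStrict (C : Type u) [Category.{v} C] [CppoEnriched C] : Prop :=
  ∀ {X Y : C} (Z : C) (f : X ⟶ Y), f ≫ (⊥ : Y ⟶ Z) = (⊥ : X ⟶ Z)

/-- An endofunctor is locally continuous if its action on each hom-set preserves joins of
`ω`-chains. -/
def LocallyContinuous {C : Type u} [Category.{v} C] [CppoEnriched C] (F : C ⥤ C) : Prop :=
  ∀ X Y : C, ωScottContinuous (fun f : X ⟶ Y => F.map f)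

end CppoEnrichment

section FreeMonad

variable {C : Type u} [Category.{v} C]

/-- A free `F`-algebra on the object `X`: an `F`-algebra with a morphism from `X` to its
carrier through which every morphism from `X` to the carrier of an `F`-algebra factors by a
unique algebra homomorphism. -/
structure FreeAlg (F : C ⥤ C) (X : C) where
  alg : Endofunctor.Algebra F
  unit : X ⟶ alg.a
  lift (B : Endofunctor.Algebra F) (f : X ⟶ B.a) : alg ⟶ B
  unit_lift (B : Endofunctor.Algebra F) (f : X ⟶ B.a) : unit ≫ (lift B f).f = f
  lift_unique (B : Endofunctor.Algebra F) (f : X ⟶ B.a) (h : alg ⟶ B) :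
    unit ≫ h.f = f → h = lift B f

theorem FreeAlg.hom_ext {F : C ⥤ C} {X : C} (A : FreeAlg F X) {B : Endofunctor.Algebra F}
    {h k : A.alg ⟶ B} (e : A.unit ≫ h.f = A.unit ≫ k.f) : h.f = k.f := by
  exact congrArg (fun t => t.f) ((A.lift_unique B _ h e).trans (A.lift_unique B _ k rfl).symm)

/-- The free monad on `F`, built from free `F`-algebras `Φ X` on all objects `X`. The
multiplication is the unique algebra homomorphism from the free algebra on the carrier of
`Φ X` to `Φ X` which extends the identity. -/
def freeMonad {F : C ⥤ C} (Φ : ∀ X : C, FreeAlg F X) : Monad C where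
  obj X := (Φ X).alg.a
  map {X Y} f := ((Φ X).lift (Φ Y).alg (f ≫ (Φ Y).unit)).f
  map_id X := by
    rw [← Endofunctor.Algebra.id_f]
    apply FreeAlg.hom_ext
    simp [FreeAlg.unit_lift]
  map_comp {X Y Z} f g := by
    rw [← Endofunctor.Algebra.comp_f]
    apply FreeAlg.hom_ext
    rw [FreeAlg.unit_lift, Endofunctor.Algebra.comp_f, ← Category.assoc, FreeAlg.unit_lift,
      Category.assoc, Category.assoc, FreeAlg.unit_lift]
  η :=
    { app := fun X => (Φ X).unit
      naturality := fun X Y f => ((Φ X).unit_lift (Φ Y).alg (f ≫ (Φ Y).unit)).symm }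
  μ :=
    { app := fun X => ((Φ (Φ X).alg.a).lift (Φ X).alg (𝟙 _)).f
      naturality := fun X Y f => by
        dsimp
        rw [← Endofunctor.Algebra.comp_f, ← Endofunctor.Algebra.comp_f]
        apply FreeAlg.hom_ext
        rw [Endofunctor.Algebra.comp_f, Endofunctor.Algebra.comp_f, ← Category.assoc,
          FreeAlg.unit_lift, ← Category.assoc, FreeAlg.unit_lift, Category.assoc,
          FreeAlg.unit_lift, Category.comp_id, Category.id_comp] }
  assoc X := by
    dsimp
    rw [← Endofunctor.Algebra.comp_f, ← Endofunctor.Algebra.comp_f]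
    apply FreeAlg.hom_ext
    rw [Endofunctor.Algebra.comp_f, Endofunctor.Algebra.comp_f, ← Category.assoc,
      FreeAlg.unit_lift, ← Category.assoc, FreeAlg.unit_lift, Category.assoc,
      FreeAlg.unit_lift, Category.comp_id, Category.id_comp]
  left_unit X := FreeAlg.unit_lift _ _ _
  right_unit X := by
    dsimp
    rw [← Endofunctor.Algebra.comp_f, ← Endofunctor.Algebra.id_f]
    apply FreeAlg.hom_ext
    rw [Endofunctor.Algebra.comp_f, ← Category.assoc, FreeAlg.unit_lift, Category.assoc,
      FreeAlg.unit_lift, Endofunctor.Algebra.id_f]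

end FreeMonad

section SystemAssumption

variable {C : Type u} [Category.{v} C]

instance [HasCoproducts.{v} C] : HasFiniteCoproducts C :=
  hasFiniteCoproducts_of_hasCoproducts.{v} C

/-- The endofunctor `T (Id + Y)`, that is `Z ↦ T (Z + Y)`. -/
noncomputable def withParameter [HasBinaryCoproducts C] (T : C ⥤ C) (Y : C) : C ⥤ C :=
  coprod.functor.flip.obj Y ⋙ T

/-- The standing assumption of the theory of systems with internal behaviour, for a
`Cppo`-enriched category `C`, an endofunctor `F` of `C` and an object `X` of `C`.

`freeMonad Φ` is the free monad on `F` and `coprodMonad (F.obj X)` is the exception monad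
`F X + Id`. An initial algebra for an endofunctor is an initial object of its category of
algebras. -/
structure SystemAssumption (C : Type u) [Category.{v} C] [CppoEnriched C] (F : C ⥤ C)
    (X : C) : Prop where
  [hasCoproducts : HasCoproducts.{v} C]
  leftStrict : LeftStrict C
  locallyContinuous : LocallyContinuous F
  hasFreeAlgebras : ∀ Y : C, Nonempty (FreeAlg F Y)
  hasInitial_freeMonad : ∀ (Φ : ∀ Z : C, FreeAlg F Z) (Y : C),
    HasInitial (Endofunctor.Algebra (withParameter (freeMonad Φ).toFunctor Y))
  hasInitial_exceptionMonad : ∀ Y : C,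
    HasInitial (Endofunctor.Algebra (withParameter (coprodMonad (F.obj X)).toFunctor Y))

end SystemAssumption

/-- `L` is a lifting of the endofunctor `H` to the Kleisli category of `M`:
`J ∘ H = L ∘ J` for the canonical functor `J` into the Kleisli category. -/
def IsKleisliLifting {C : Type u} [Category.{v} C] (M : Monad C) (H : C ⥤ C)
    (L : Kleisli M ⥤ Kleisli M) : Prop :=
  H ⋙ Kleisli.Adjunction.toKleisli M = Kleisli.Adjunction.toKleisli M ⋙ L

end InternalSystems

/-! All the required initial and free objects are instances of one notion: an object freely
generated under algebra structures for a family of functors. Over sets, such objects exist for a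
small family of bounded functors, as terms modulo equality of values in all algebras; accessible
functors are bounded. The left adjoint `Kleisli.Adjunction.toKleisli M` carries them to free joint
algebras of the liftings. The families `{H}`, `{Id, H}` and `{Id}` then give the free monad, its
parametrised initial algebras (`hasInitial_algebra_freeMonad`) and those of the exception monad. -/

namespace InternalSystems

/-! ### Free joint algebras and their transport along left adjoints. -/

section JointAlgebras

universe v₁ u₁ v₂ u₂ w

variable {C : Type u₁} [Category.{v₁} C] {D : Type u₂} [Category.{v₂} D] {ι : Type w}

/-- `A`, with structure morphisms for all functors of the family `F`, is freely generated by
`unit : X ⟶ A` among the objects which are algebras for all functors of the family. -/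
def IsFreeJointAlg (F : ι → C ⥤ C) {X A : C} (str : ∀ i, (F i).obj A ⟶ A) (unit : X ⟶ A) :
    Prop :=
  ∀ (B : C) (b : ∀ i, (F i).obj B ⟶ B) (f : X ⟶ B),
    ∃! h : A ⟶ B, (∀ i, (F i).map h ≫ b i = str i ≫ h) ∧ unit ≫ h = f

/-- Structure maps `L i B ⟶ B` induce structure maps on `U B`, the transposes of `J (H i (U B)) ≅ L
i (J (U B)) ⟶ L i B ⟶ B`. Transposition then matches joint homomorphisms `J A ⟶ B` with joint
homomorphisms `A ⟶ U B`. -/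
theorem IsFreeJointAlg.map_leftAdjoint {J : C ⥤ D} {U : D ⥤ C} (adj : J ⊣ U)
    {H : ι → C ⥤ C} {L : ι → D ⥤ D} (e : ∀ i, H i ⋙ J ≅ J ⋙ L i) {X A : C}
    {str : ∀ i, (H i).obj A ⟶ A} {unit : X ⟶ A} (hA : IsFreeJointAlg H str unit) :
    IsFreeJointAlg L (fun i => (e i).inv.app A ≫ J.map (str i)) (J.map unit) := by
  intro B b f
  have key (h : J.obj A ⟶ B) :
      ((∀ i, (H i).map (adj.homEquiv _ _ h) ≫ adj.homEquiv _ _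
          ((e i).hom.app (U.obj B) ≫ (L i).map (adj.counit.app B) ≫ b i) =
          str i ≫ adj.homEquiv _ _ h) ∧ unit ≫ adj.homEquiv _ _ h = adj.homEquiv _ _ f) ↔
      ((∀ i, (L i).map h ≫ b i = ((e i).inv.app A ≫ J.map (str i)) ≫ h) ∧
        J.map unit ≫ h = f) := by
    refine and_congr (forall_congr' fun i => ?_) ?_
    · rw [← adj.homEquiv_naturality_left, ← adj.homEquiv_naturality_left,
        (adj.homEquiv _ _).apply_eq_iff_eq, Category.assoc, ← Iso.app_inv, Iso.eq_inv_comp,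
        Iso.app_hom, ← Category.assoc]
      have n := (e i).hom.naturality (adj.homEquiv _ _ h)
      have c : J.map (adj.homEquiv _ _ h) ≫ adj.counit.app B = h :=
        (adj.homEquiv_counit _ _ _).symm.trans (Equiv.symm_apply_apply _ _)
      dsimp only [Functor.comp_map] at n
      dsimp only [Functor.comp_obj, Functor.id_obj] at c ⊢
      rw [n, Category.assoc, ← Category.assoc ((L i).map _), ← (L i).map_comp, c]
    · rw [← adj.homEquiv_naturality_left, (adj.homEquiv _ _).apply_eq_iff_eq]
  obtain ⟨h, hh, hu⟩ := hA (U.obj B) (fun i => adj.homEquiv _ _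
    ((e i).hom.app (U.obj B) ≫ (L i).map (adj.counit.app B) ≫ b i)) (adj.homEquiv _ _ f)
  refine ⟨(adj.homEquiv _ _).symm h, (key _).1 (by simpa only [Equiv.apply_symm_apply] using hh),
    fun k hk => ?_⟩
  rw [Equiv.eq_symm_apply]
  exact hu _ ((key k).2 hk)

theorem IsFreeJointAlg.nonempty_freeAlg {F : C ⥤ C} {X A : C}
    {str : PUnit.{w + 1} → (F.obj A ⟶ A)}
    {unit : X ⟶ A} (hA : IsFreeJointAlg (fun _ : PUnit.{w + 1} => F) str unit) :
    Nonempty (FreeAlg F X) := by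
  choose h hh hu using fun (B : Endofunctor.Algebra F) (f : X ⟶ B.a) =>
    hA B.a (fun _ => B.str) f
  exact ⟨{
    alg := ⟨A, str ⟨⟩⟩
    unit := unit
    lift := fun B f => ⟨h B f, (hh B f).1 ⟨⟩⟩
    unit_lift := fun B f => (hh B f).2
    lift_unique := fun B f k hk => Endofunctor.Algebra.Hom.ext (hu B f k.f ⟨fun _ => k.h, hk⟩) }⟩

end JointAlgebras

/-! ### Accessible functors on sets are bounded. -/

section Bounded

/-- Every element of `H Z` lies in the image of `H (T s)` for a map `T s → Z` out of one of a
small family of sets. -/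
def IsBoundedFunctor (H : Type u ⥤ Type u) : Prop :=
  ∃ (S : Type u) (T : S → Type u), ∀ (Z : Type u) (x : H.obj Z),
    ∃ (s : S) (t : T s ⟶ Z) (y : H.obj (T s)), H.map t y = x

theorem isBoundedFunctor_of_isAccessible (H : Type u ⥤ Type u) [hH : H.IsAccessible.{u}] :
    IsBoundedFunctor H := by
  obtain ⟨κ, hκ, _⟩ := hH.exists_cardinal
  -- Every set is the `κ`-filtered colimit of its subsets of size below `κ`, and each of these is
  -- isomorphic to a subset of `κ.ord.ToType`.
  refine ⟨Set κ.ord.ToType, fun s => s, fun Z x => ?_⟩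
  have := H.preservesColimitsOfShape_of_isCardinalAccessible κ (HasCardinalLT.Set Z κ)
  obtain ⟨A, y, rfl⟩ := Types.jointly_surjective_of_isColimit
    (isColimitOfPreserves H (HasCardinalLT.Set.isColimitCocone Z κ hκ.out.aleph0_le)) x
  have hA : Cardinal.mk A.1 ≤ Cardinal.mk κ.ord.ToType := by
    rw [Cardinal.mk_ord_toType]
    exact ((hasCardinalLT_iff_cardinal_mk_lt _ _).1 A.2).le
  obtain ⟨g⟩ := hA
  let e := (Equiv.ofInjective g g.injective).toIso
  let c : (HasCardinalLT.Set.functor Z κ).obj A ⟶ Z := (HasCardinalLT.Set.cocone Z κ).ι.app A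
  refine ⟨Set.range g, e.inv ≫ c, H.map e.hom y, ?_⟩
  change (H.map e.hom ≫ H.map (e.inv ≫ c)) y = H.map c y
  rw [← H.map_comp]
  congr 2
  exact congrArg H.map (e.hom_inv_id_assoc c)

theorem isBoundedFunctor_id : IsBoundedFunctor (𝟭 (Type u)) :=
  ⟨PUnit, fun _ => PUnit, fun _ x => ⟨⟨⟩, ↾fun _ => x, PUnit.unit, rfl⟩⟩

end Bounded

/-! ### Free joint algebras of bounded functors on sets. -/

section Terms

variable {ι : Type u} (H : ι → Type u ⥤ Type u) {S : ι → Type u} (T : ∀ i, S i → Type u)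
  (Y : Type u)

/-- Terms over the variables `Y` with an operation of arity `T i s` for every element of
`H i (T i s)`. -/
inductive Term : Type u
  | var (y : Y) : Term
  | node (i : ι) (s : S i) (x : (H i).obj (T i s)) (t : T i s → Term) : Term

variable {H T Y}

/-- The value of a term in an object which is an algebra for all functors of the family. -/
def Term.eval {B : Type u} (b : ∀ i, (H i).obj B ⟶ B) (f : Y ⟶ B) : Term H T Y → B
  | var y => f y
  | node i _ x t => b i ((H i).map (↾fun j => (t j).eval b f) x)

variable (H T Y)

/-- Two terms are identified if they have the same value in all algebras. -/
def termSetoid : Setoid (Term H T Y) where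
  r p q := ∀ (B : Type u) (b : ∀ i, (H i).obj B ⟶ B) (f : Y ⟶ B), p.eval b f = q.eval b f
  iseqv := ⟨fun _ _ _ _ => rfl, fun h B b f => (h B b f).symm,
    fun h k B b f => (h B b f).trans (k B b f)⟩

/-- Terms up to equality of their values. -/
abbrev TermQuotient : Type u := Quotient (termSetoid H T Y)

variable {H T Y}

/-- The value of a class of terms. -/
def TermQuotient.eval {B : Type u} (b : ∀ i, (H i).obj B ⟶ B) (f : Y ⟶ B) :
    TermQuotient H T Y ⟶ B :=
  ↾Quotient.lift (Term.eval b f) fun _ _ h => h B b f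

theorem TermQuotient.eval_node {B : Type u} (b : ∀ i, (H i).obj B ⟶ B) (f : Y ⟶ B) {i : ι}
    {s : S i} (x : (H i).obj (T i s)) (t : T i s → Term H T Y) :
    (Term.node i s x t).eval b f = b i ((H i).map (TermQuotient.eval b f)
      ((H i).map (↾fun j => (Quotient.mk _ (t j) : TermQuotient H T Y)) x)) := by
  change _ = b i (((H i).map _ ≫ (H i).map _) x)
  rw [← (H i).map_comp]
  rfl

/-- Boundedness presents each `z` as some `H(t)(y)`. The choice is immaterial: by
`TermQuotient.eval_node` the value of a node depends only on the element it presents. -/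
theorem TermQuotient.exists_str
    (hT : ∀ (i : ι) (Z : Type u) (x : (H i).obj Z),
      ∃ (s : S i) (t : T i s ⟶ Z) (y : (H i).obj (T i s)), (H i).map t y = x) (i : ι) :
    ∃ str : (H i).obj (TermQuotient H T Y) ⟶ TermQuotient H T Y,
      ∀ (s : S i) (x : (H i).obj (T i s)) (t : T i s → Term H T Y),
        str ((H i).map (↾fun j => (Quotient.mk _ (t j) : TermQuotient H T Y)) x) =
          Quotient.mk _ (Term.node i s x t) := by
  have hT' (z : (H i).obj (TermQuotient H T Y)) : ∃ (s : S i) (t : T i s → Term H T Y)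
      (y : (H i).obj (T i s)),
        (H i).map (↾fun j => (Quotient.mk _ (t j) : TermQuotient H T Y)) y = z := by
    obtain ⟨s, t, y, rfl⟩ := hT i _ z
    refine ⟨s, fun j => (t j).out, y, ?_⟩
    congr 3
    ext j
    exact Quotient.out_eq (t j)
  choose s t y h using hT'
  refine ⟨↾fun z => Quotient.mk _ (Term.node i (s z) (y z) (t z)), fun s' x t' => ?_⟩
  refine Quotient.sound fun B b f => ?_
  rw [TermQuotient.eval_node, TermQuotient.eval_node, h]

theorem exists_isFreeJointAlg (H : ι → Type u ⥤ Type u) (hH : ∀ i, IsBoundedFunctor (H i))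
    (Y : Type u) : ∃ (A : Type u) (str : ∀ i, (H i).obj A ⟶ A) (unit : Y ⟶ A),
      IsFreeJointAlg H str unit := by
  choose S T hT using hH
  choose str hstr using TermQuotient.exists_str (Y := Y) hT
  refine ⟨TermQuotient H T Y, str, ↾fun y => Quotient.mk _ (Term.var y), fun B b f =>
    ⟨TermQuotient.eval b f, ⟨fun i => ?_, rfl⟩, fun k hk => ?_⟩⟩
  · ext z
    obtain ⟨s, t, y, rfl⟩ := hT i _ z
    obtain ⟨t, rfl⟩ : ∃ t' : T i s → Term H T Y, t = ↾fun j => Quotient.mk _ (t' j) :=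
      ⟨fun j => (t j).out, by ext j; exact (Quotient.out_eq (t j)).symm⟩
    change b i ((H i).map _ _) = TermQuotient.eval b f (str i _)
    rw [hstr, ← TermQuotient.eval_node]
    rfl
  · ext z
    induction z using Quotient.inductionOn with | _ p
    change _ = p.eval b f
    induction p with
    | var y => exact ConcreteCategory.congr_hom hk.2 y
    | node i s x t ih =>
      rw [← hstr]
      change (str i ≫ k) _ = _
      rw [← hk.1 i]
      change b i (((H i).map _ ≫ (H i).map k) x) = b i _
      rw [← (H i).map_comp]
      have e : (↾fun j => (Quotient.mk _ (t j) : TermQuotient H T Y)) ≫ k =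
          ↾fun j => (t j).eval b f := by
        ext j
        exact ih j
      rw [e]

end Terms
-- Initial algebras with parameters from free joint algebras.
section InitialAlgebras

universe v₁ u₁ w

variable {C : Type u₁} [Category.{v₁} C]

theorem hasInitial_algebra_of_existsUnique {F : C ⥤ C} (A : Endofunctor.Algebra F)
    (hA : ∀ B : Endofunctor.Algebra F, ∃! h : A.a ⟶ B.a, F.map h ≫ B.str = A.str ≫ h) :
    HasInitial (Endofunctor.Algebra F) := by
  choose h hh hu using hA
  exact IsInitial.hasInitial (IsInitial.ofUniqueHom (X := A) (fun B => ⟨h B, hh B⟩)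
    fun B m => Endofunctor.Algebra.Hom.ext (hu B m.f m.h))

theorem FreeAlg.lift_ext {F : C ⥤ C} {X : C} (A : FreeAlg F X) {B : C} (b : F.obj B ⟶ B)
    {h k : A.alg.a ⟶ B} (hh : F.map h ≫ b = A.alg.str ≫ h) (hk : F.map k ≫ b = A.alg.str ≫ k)
    (e : A.unit ≫ h = A.unit ≫ k) : h = k :=
  A.hom_ext (B := ⟨B, b⟩) (h := ⟨h, hh⟩) (k := ⟨k, hk⟩) e

variable [HasBinaryCoproducts C]

/-- The diagonal rule: an object freely generated by `Y` under an `F`-algebra structure and an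
endomorphism is an initial algebra for `Z ↦ F* (Z + Y)`. -/
theorem hasInitial_algebra_freeMonad {F : C ⥤ C} (Φ : ∀ Z : C, FreeAlg F Z) {Y A : C}
    {a : F.obj A ⟶ A} {e : A ⟶ A} {y : Y ⟶ A}
    (hA : ∀ (B : C) (b : F.obj B ⟶ B) (d : B ⟶ B) (f : Y ⟶ B),
      ∃! h : A ⟶ B, F.map h ≫ b = a ≫ h ∧ h ≫ d = e ≫ h ∧ y ≫ h = f) :
    HasInitial (Endofunctor.Algebra (withParameter (freeMonad Φ).toFunctor Y)) := by
  let V (B : C) : FreeAlg F (B ⨿ Y) := Φ (B ⨿ Y)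
  let G := withParameter (freeMonad Φ).toFunctor Y
  let g {B B' : C} (h : B ⟶ B') : (V B).alg.a ⟶ (V B').alg.a := G.map h
  have g_unit {B B' : C} (h : B ⟶ B') : (V B).unit ≫ g h =
      coprod.desc (h ≫ coprod.inl ≫ (V B').unit) (coprod.inr ≫ (V B').unit) := by
    have : (V B).unit ≫ g h = coprod.map h (𝟙 Y) ≫ (V B').unit := (V B).unit_lift _ _
    rw [this]
    ext <;> simp [coprod.inl_desc, coprod.inr_desc]
  have g_str {B B' : C} (h : B ⟶ B') :
      F.map (g h) ≫ (V B').alg.str = (V B).alg.str ≫ g h :=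
    ((V B).lift _ _).h
  let t : (V A).alg.a ⟶ A := ((V A).lift ⟨A, a⟩ (coprod.desc e y)).f
  have t_str : F.map t ≫ a = (V A).alg.str ≫ t := ((V A).lift ⟨A, a⟩ (coprod.desc e y)).h
  have t_unit : (V A).unit ≫ t = coprod.desc e y := (V A).unit_lift _ _
  -- `F* (B + Y)` gets the endomorphism that applies `b` and reinserts the result as a variable.
  have solve (B : C) (b : (V B).alg.a ⟶ B) := hA (V B).alg.a (V B).alg.str
    (b ≫ coprod.inl ≫ (V B).unit) (coprod.inr ≫ (V B).unit)
  refine hasInitial_algebra_of_existsUnique (F := G) ⟨A, t⟩ fun ⟨B, b⟩ => ?_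
  change ∃! h : A ⟶ B, g h ≫ b = t ≫ h
  change (V B).alg.a ⟶ B at b
  obtain ⟨k, ⟨k_str, k_end, k_gen⟩, k_uniq⟩ := solve B b
  refine ⟨k ≫ b, ?_, fun h hh => ?_⟩
  · have : g (k ≫ b) = t ≫ k := by
      refine (V A).lift_ext (V B).alg.str (g_str _) ?_ ?_
      · rw [F.map_comp, Category.assoc, k_str, reassoc_of% t_str]
      · rw [g_unit, reassoc_of% t_unit]
        ext
        · simpa [coprod.inl_desc, coprod.inr_desc] using k_end
        · simpa [coprod.inl_desc, coprod.inr_desc] using k_gen.symm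
    change g (k ≫ b) ≫ b = t ≫ k ≫ b
    rw [this, Category.assoc]
  -- `l` is a section of `t`, so a homomorphism `h` equals `(l ≫ g h) ≫ b`; and `l ≫ g h` satisfies
  -- the equations that determine `k`.
  · obtain ⟨l, ⟨l_str, l_end, l_gen⟩, -⟩ := solve A t
    have lt : l ≫ t = 𝟙 A := by
      refine (hA A a e y).unique ⟨?_, ?_, ?_⟩ (by simp)
      · rw [F.map_comp, Category.assoc, t_str, reassoc_of% l_str]
      · rw [← reassoc_of% l_end, t_unit, coprod.inl_desc, Category.assoc]
      · rw [reassoc_of% l_gen, t_unit, coprod.inr_desc]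
    have hl : h = (l ≫ g h) ≫ b := by
      change g h ≫ b = t ≫ h at hh
      rw [Category.assoc, hh, reassoc_of% lt]
    have := k_uniq (l ≫ g h) ⟨?_, ?_, ?_⟩
    · rw [hl, this]
    · rw [F.map_comp, Category.assoc, g_str, reassoc_of% l_str]
    · rw [← Category.assoc, ← hl, ← reassoc_of% l_end, g_unit, coprod.inl_desc,
        reassoc_of% lt]
    · rw [reassoc_of% l_gen, g_unit, coprod.inr_desc]

/-- The object freely generated by `E + Y` under an endomorphism is an initial algebra for
`Z ↦ E + (Z + Y)`. -/
theorem IsFreeJointAlg.hasInitial_algebra_coprodMonad {E Y A : C}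
    {str : PUnit.{w + 1} → (A ⟶ A)} {unit : E ⨿ Y ⟶ A}
    (hA : IsFreeJointAlg (fun _ : PUnit.{w + 1} => 𝟭 C) str unit) :
    HasInitial (Endofunctor.Algebra (withParameter (coprodMonad E).toFunctor Y)) := by
  refine hasInitial_algebra_of_existsUnique
    ⟨A, coprod.desc (coprod.inl ≫ unit) (coprod.desc (str ⟨⟩) (coprod.inr ≫ unit))⟩
    fun ⟨B, b⟩ => ?_
  change E ⨿ (B ⨿ Y) ⟶ B at b
  -- A map `E + (B + Y) ⟶ B` amounts to an endomorphism of `B` and a map `E + Y ⟶ B`.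
  have key (h : A ⟶ B) :
      ((∀ i, (𝟭 C).map h ≫ coprod.inl ≫ coprod.inr ≫ b = str i ≫ h) ∧
        unit ≫ h = coprod.desc (coprod.inl ≫ b) (coprod.inr ≫ coprod.inr ≫ b)) ↔
      coprod.map (𝟙 E) (coprod.map h (𝟙 Y)) ≫ b =
        coprod.desc (coprod.inl ≫ unit) (coprod.desc (str ⟨⟩) (coprod.inr ≫ unit)) ≫ h := by
    constructor
    · rintro ⟨h₁, h₂⟩
      have h₁ := h₁ ⟨⟩
      ext <;> simp [h₂, ← h₁, coprod.inl_desc, coprod.inr_desc]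
    · intro H
      refine ⟨fun _ => ?_, ?_⟩
      · simpa [coprod.inl_desc, coprod.inr_desc] using congr(coprod.inl ≫ coprod.inr ≫ $H)
      · ext
        · simpa [coprod.inl_desc, coprod.inr_desc] using congr(coprod.inl ≫ $H).symm
        · simpa [coprod.inl_desc, coprod.inr_desc] using congr(coprod.inr ≫ coprod.inr ≫ $H).symm
  exact (existsUnique_congr key).1 (hA _ _ _)

end InitialAlgebras

/-! ### Application to Kleisli categories. -/

section Kleisli

variable (M : Monad (Type u))

/-- The canonical functor preserves colimits and is the identity on objects, so every discrete
diagram lifts to sets. -/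
theorem hasCoproducts_kleisli : HasCoproducts.{u} (Kleisli M) := fun J => ⟨fun F => by
  have : PreservesColimitsOfSize.{u, u} (Kleisli.Adjunction.toKleisli M) :=
    (Kleisli.Adjunction.adj M).leftAdjoint_preservesColimits
  have e : (Discrete.functor fun j => (F.obj ⟨j⟩).of) ⋙ Kleisli.Adjunction.toKleisli M ≅ F :=
    Discrete.natIso fun _ => Iso.refl _
  exact hasColimit_of_iso e.symm⟩

theorem exists_isFreeJointAlg_kleisli {ι : Type u} {H : ι → Type u ⥤ Type u}
    (hH : ∀ i, IsBoundedFunctor (H i)) {L : ι → Kleisli M ⥤ Kleisli M}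
    (hL : ∀ i, IsKleisliLifting M (H i) (L i)) (Y : Kleisli M) :
    ∃ (A : Kleisli M) (str : ∀ i, (L i).obj A ⟶ A) (unit : Y ⟶ A),
      IsFreeJointAlg L str unit := by
  obtain ⟨A, str, unit, hA⟩ := exists_isFreeJointAlg H hH Y.of
  exact ⟨_, _, _, hA.map_leftAdjoint (Kleisli.Adjunction.adj M) fun i => eqToIso (hL i)⟩

theorem isKleisliLifting_id : IsKleisliLifting M (𝟭 _) (𝟭 _) := rfl

end Kleisli

end InternalSystems

open InternalSystems in
theorem mainTheorem5
    (M : CategoryTheory.Monad (Type u))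
    [InternalSystems.CppoEnriched (Kleisli M)]
    (hstrict : InternalSystems.LeftStrict (Kleisli M))
    (H : Type u ⥤ Type u) (hH : H.IsAccessible.{u})
    (L : Kleisli M ⥤ Kleisli M)
    (hlift : InternalSystems.IsKleisliLifting M H L)
    (hcont : InternalSystems.LocallyContinuous L)
    (X : Type u) :
    InternalSystems.SystemAssumption (Kleisli M) L
      ((Kleisli.Adjunction.toKleisli M).obj X) := by
  have := hasCoproducts_kleisli M
  have hH := isBoundedFunctor_of_isAccessible H
  have hId := isBoundedFunctor_id
  refine ⟨hstrict, hcont, fun Y => ?_, fun Φ Y => ?_, fun Y => ?_⟩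
  · obtain ⟨A, str, unit, hA⟩ := exists_isFreeJointAlg_kleisli M
      (fun _ : PUnit.{u + 1} => hH) (fun _ => hlift) Y
    exact hA.nonempty_freeAlg
  -- `none` indexes the identity functor, whose algebras are endomorphisms, and `some` indexes `H`.
  · obtain ⟨A, str, unit, hA⟩ := exists_isFreeJointAlg_kleisli M (ι := Option PUnit.{u + 1})
      (H := fun i => i.elim (𝟭 _) fun _ => H) (L := fun i => i.elim (𝟭 _) fun _ => L)
      (by rintro (_ | _) <;> assumption)
      (by rintro (_ | _); exacts [isKleisliLifting_id M, hlift]) Y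
    refine hasInitial_algebra_freeMonad Φ (a := str (some ⟨⟩)) (e := str none) (y := unit)
      fun B b d f => ?_
    refine (existsUnique_congr fun h => ?_).1 (hA B (fun | none => d | some _ => b) f)
    rw [Option.forall, and_comm (a := _ = _), and_assoc]
    exact and_congr ⟨fun h => h ⟨⟩, fun h _ => h⟩ Iff.rfl
  · obtain ⟨A, str, unit, hA⟩ := exists_isFreeJointAlg_kleisli M
      (fun _ : PUnit.{u + 1} => hId) (fun _ => isKleisliLifting_id M)
      (L.obj ((Kleisli.Adjunction.toKleisli M).obj X) ⨿ Y)
    exact hA.hasInitial_algebra_coprodMonad
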